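/- Let $d \ge 1$ and let $C \subset \mathbb{R}^d$ be compact. The *bounded gaps* of $C$ are the bounded path-connected components of $\mathbb{R}^d \setminus C$, and the *unbounded gap* $E$ of $C$ is the union of the unbounded path-connected components of $\mathbb{R}^d \setminus C$. If $C$ has at least one bounded gap, the *thickness* of $C$ is $$\tau(C) := \inf_{G} \frac{\operatorname{dist}\Big(G,\; E \cup \bigcup \{H : H \ne G \text{ a bounded gap of } C,\ \operatorname{diam}(H) \ge \operatorname{diam}(G)\}\Big)}{\operatorname{diam}(G)},$$ where $G$ ranges over the bounded gaps of $C$; whenever the bounded gaps can be listed as $G_1, G_2, \dots$ by non-increasing diameter, this equals $\inf_n \operatorname{dist}\big(G_n, E \cup \bigcup_{i<n} G_i\big)/\operatorname{diam}(G_n)$. If $C$ has no bounded gap, then $\tau(C) := +\infty$ when $C$ has non-empty interior, and $\tau(C) := 0$ when $C$ has empty interior. In products of thicknesses, $0 \cdot \infty = 0$. **Corollary.** Let $d \ge 1$ and let $C_1, C_2 \subset \mathbb{R}^d$ be compact sets with $\tau(C_1)\,\tau(C_2) > 1$. Then for every $x \in C_1 \times C_2 \subset \mathbb{R}^{2d}$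 the pinned distance set $$\Delta_x(C_1 \times C_2) := \{\, |x - y| : y \in C_1 \times C_2 \,\} \subset \mathbb{R},$$ where $|\cdot|$ is the Euclidean norm on $\mathbb{R}^{2d}$, has non-empty interior in $\mathbb{R}$. -/

import Mathlib

open scoped ENNReal

/-- The bounded gaps of `C`: the bounded path-connected components of the complement of `C`. -/
def boundedGaps {d : ℕ} (C : Set (EuclideanSpace ℝ (Fin d))) :
    Set (Set (EuclideanSpace ℝ (Fin d))) :=
  {G | (∃ p ∈ Cᶜ, G = pathComponentIn Cᶜ p) ∧ Bornology.IsBounded G}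

/-- The unbounded gap `E` of `C`: the union of the unbounded path-connected components of the
complement of `C`. For compact `C` this is a single component if `d ≥ 2`, and the union of two
unbounded open intervals if `d = 1` and `C` is non-empty. -/
def unboundedGap {d : ℕ} (C : Set (EuclideanSpace ℝ (Fin d))) :
    Set (EuclideanSpace ℝ (Fin d)) :=
  {p | p ∈ Cᶜ ∧ ¬ Bornology.IsBounded (pathComponentIn Cᶜ p)}

/-- The distance `inf {|p - q| : p ∈ A, q ∈ B}` between two sets, as an extended nonnegative real. -/
noncomputable def setDist {d : ℕ} (A B : Set (EuclideanSpace ℝ (Fin d))) : ℝ≥0∞ :=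
  ⨅ p ∈ A, ⨅ q ∈ B, edist p q

/-- The infimum, over the bounded gaps `G` of `C`, of the distance from `G` to the union of the
unbounded gap and of the other bounded gaps of diameter at least `diam G`, divided by `diam G`.
The next lemma shows that it is the infimum of
`dist (G n, G 1 ∪ ... ∪ G (n - 1) ∪ E) / diam (G n)` for every enumeration `G 1, G 2, ...` of the
bounded gaps by non-increasing diameter. -/
noncomputable def gapRatioInf {d : ℕ} (C : Set (EuclideanSpace ℝ (Fin d))) : ℝ≥0∞ :=
  ⨅ G ∈ boundedGaps C,
    setDist G
      ((⋃ H ∈ {H ∈ boundedGaps C | H ≠ G ∧ Metric.ediam G ≤ Metric.ediam H}, H) ∪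
        unboundedGap C) / Metric.ediam G

/-- For every enumeration (finite or infinite) of the bounded gaps by non-increasing diameter,
`gapRatioInf` is given by comparing each gap with the earlier ones and the unbounded gap. -/
theorem gapRatioInf_eq_iInf_enumeration {d : ℕ} (hd : 1 ≤ d)
    (C : Set (EuclideanSpace ℝ (Fin d))) (hC : IsCompact C)
    (s : Set ℕ) (G : ℕ → Set (EuclideanSpace ℝ (Fin d)))
    (hG : Set.BijOn G s (boundedGaps C))
    (hdiam : ∀ i ∈ s, ∀ j ∈ s, i ≤ j → Metric.ediam (G j) ≤ Metric.ediam (G i)) :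
    gapRatioInf C =
      ⨅ n ∈ s, setDist (G n) ((⋃ i ∈ {i ∈ s | i < n}, G i) ∪ unboundedGap C) /
        Metric.ediam (G n) := by
  have hanti : ∀ A B B' : Set (EuclideanSpace ℝ (Fin d)), B ⊆ B' → setDist A B' ≤ setDist A B :=
    fun A B B' h => iInf₂_mono fun p _ => biInf_mono h
  apply le_antisymm
  · refine le_iInf₂ fun n hn => (iInf₂_le (G n) (hG.mapsTo hn)).trans ?_
    refine ENNReal.div_le_div_right (hanti _ _ _ ?_) _
    refine Set.union_subset_union_left _ (Set.iUnion₂_subset fun i hi => ?_)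
    refine Set.subset_biUnion_of_mem (u := fun H => H) ?_
    exact ⟨hG.mapsTo hi.1, fun h => hi.2.ne (hG.injOn hi.1 hn h), hdiam i hi.1 n hn hi.2.le⟩
  · refine le_iInf₂ fun A hA => ?_
    obtain ⟨n, hn, rfl⟩ := hG.surjOn hA
    have h0 : Metric.ediam (G n) ≠ ⊤ := Metric.isBounded_iff_ediam_ne_top.1 hA.2
    have hne : Metric.ediam (G n) ≠ 0 := by
      obtain ⟨⟨p, hp, hGp⟩, -⟩ := hA
      have : Nonempty (Fin d) := ⟨⟨0, hd⟩⟩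
      rw [hGp, Ne, Metric.ediam_eq_zero_iff]
      intro hsub
      have hnhds : pathComponentIn Cᶜ p ∈ nhds p :=
        (hC.isClosed.isOpen_compl.pathComponentIn p).mem_nhds (mem_pathComponentIn_self hp)
      exact (infinite_of_mem_nhds p hnhds) hsub.finite
    -- it suffices to bound the ratio for each pair of points
    have key : ∀ p ∈ G n, ∀ q ∈ ((⋃ H ∈ {H ∈ boundedGaps C | H ≠ G n ∧
        Metric.ediam (G n) ≤ Metric.ediam H}, H) ∪ unboundedGap C),
        (⨅ n ∈ s, setDist (G n) ((⋃ i ∈ {i ∈ s | i < n}, G i) ∪ unboundedGap C) /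
          Metric.ediam (G n)) ≤ edist p q / Metric.ediam (G n) := by
      intro p hp q hq
      have hle : ∀ m ∈ s, ∀ p ∈ G m, ∀ q ∈ ((⋃ i ∈ {i ∈ s | i < m}, G i) ∪ unboundedGap C),
          (⨅ n ∈ s, setDist (G n) ((⋃ i ∈ {i ∈ s | i < n}, G i) ∪ unboundedGap C) /
            Metric.ediam (G n)) ≤ edist p q / Metric.ediam (G m) := fun m hm p hp q hq =>
        (iInf₂_le m hm).trans (ENNReal.div_le_div_right
          ((iInf₂_le p hp).trans (iInf₂_le q hq)) _)
      rcases hq with hq | hq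
      · obtain ⟨H, ⟨hH, hHn, hHd⟩, hqH⟩ := Set.mem_iUnion₂.1 hq
        obtain ⟨m, hm, rfl⟩ := hG.surjOn hH
        rcases lt_trichotomy m n with h | h | h
        · exact hle n hn p hp q (Or.inl (Set.mem_iUnion₂.2 ⟨m, ⟨hm, h⟩, hqH⟩))
        · exact absurd (h ▸ rfl) hHn
        · have := hle m hm q hqH p (Or.inl (Set.mem_iUnion₂.2 ⟨n, ⟨hn, h⟩, hp⟩))
          rwa [edist_comm, le_antisymm (hdiam n hn m hm h.le) hHd] at this
      · exact hle n hn p hp q (Or.inr hq)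
    rw [ENNReal.le_div_iff_mul_le (Or.inl hne) (Or.inl h0)]
    refine le_iInf₂ fun p hp => le_iInf₂ fun q hq => ?_
    rw [← ENNReal.le_div_iff_mul_le (Or.inl hne) (Or.inl h0)]
    exact key p hp q hq

open Classical in
/-- The thickness `τ(C) ∈ [0, ∞]` of a compact set `C`. -/
noncomputable def thickness {d : ℕ} (C : Set (EuclideanSpace ℝ (Fin d))) : ℝ≥0∞ :=
  if (boundedGaps C).Nonempty then gapRatioInf C
  else if (interior C).Nonempty then ⊤ else 0

/-- The product `A × B ⊆ ℝ^d × ℝ^d = ℝ^(2d)`, where `ℝ^d × ℝ^d` carries the Euclidean norm. -/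
def euclideanProd {d : ℕ} (A B : Set (EuclideanSpace ℝ (Fin d))) :
    Set (WithLp 2 (EuclideanSpace ℝ (Fin d) × EuclideanSpace ℝ (Fin d))) :=
  {z | z.fst ∈ A ∧ z.snd ∈ B}

/-- The pinned distance set `Δ_x(C) = {|x - y| : y ∈ C}`. -/
def pinnedDistanceSet {X : Type*} [NormedAddCommGroup X] (x : X) (C : Set X) : Set ℝ :=
  {t | ∃ y ∈ C, t = ‖x - y‖}

/-!
By Pythagoras, the squared distances from `x` to `C₁ × C₂` form the sumset of the squared distances
from `x.fst` to `C₁` and from `x.snd` to `C₂`. By Newhouse's gap lemma (`IsThick.inter_nonempty`,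
applied to one compact set and to a reflection of the other), a sumset of two compact subsets of
the line has non-empty interior as soon as the product of their thicknesses exceeds one. It is
therefore enough that the squared distances from a point to a compact set `C` contain, for every
`τ < thickness C`, a compact set of thickness at least `τ`.

If `C` has interior points or `d ≥ 2`, they even contain an interval. Indeed, for `d ≥ 2` let `q` be
the point of the closure of a bounded gap `G` farthest from `x`. A sphere around `x` whose radius
slightly exceeds `dist x q` must meet `C`: otherwise, being connected and at least as large as `G`,
it would lie in the unbounded gap or in a gap at least as large as `G`, and it passes too close to
`q` for the thickness of `C` to be positive.

If `d = 1` and `C` has no interior points, the piece of `C` between two gaps that are longest in a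
short interval is as thick as `C`, and on a short interval away from `x` the squared distance is
nearly affine, so that it barely decreases the thickness.
-/

open Set Filter Topology Pointwise

section Gaps

variable {α : Type*} [LinearOrder α]

/-- `(a, b)` is a bounded gap of a subset `K` of a linear order: both endpoints belong to `K` and
no point of `K` lies strictly between them. -/
structure IsGap (K : Set α) (a b : α) : Prop where
  lt : a < b
  left_mem : a ∈ K
  right_mem : b ∈ K
  le_or_le : ∀ z ∈ K, z ≤ a ∨ b ≤ z

/-- The pairs of points of `K` with no point of `K` strictly between them. The degenerate pairs
`(t, t)` are allowed on purpose: they make this set compact when `K` is, so that extremal gaps can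
be found by compactness. -/
def gapPairs (K : Set α) : Set (α × α) :=
  {p ∈ K ×ˢ K | ∀ z ∈ K, z ≤ p.1 ∨ p.2 ≤ z}

theorem isGap_iff {K : Set α} {a b : α} : IsGap K a b ↔ a < b ∧ (a, b) ∈ gapPairs K :=
  ⟨fun h => ⟨h.lt, ⟨h.left_mem, h.right_mem⟩, h.le_or_le⟩,
    fun ⟨hlt, ⟨ha, hb⟩, h⟩ => ⟨hlt, ha, hb, h⟩⟩

theorem IsGap.of_inter_ordConnected {K s : Set α} {a b : α} (h : IsGap (K ∩ s) a b)
    (hs : s.OrdConnected) : IsGap K a b := by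
  refine ⟨h.lt, h.left_mem.1, h.right_mem.1, fun z hz => ?_⟩
  by_contra! hzab
  have hzs : z ∈ s := hs.out h.left_mem.2 h.right_mem.2 ⟨hzab.1.le, hzab.2.le⟩
  exact (h.le_or_le z ⟨hz, hzs⟩).elim (not_le.2 hzab.1) (not_le.2 hzab.2)

theorem IsGap.exists_of_image {β : Type*} [LinearOrder β] {K : Set α} {φ : α → β}
    (hφ : StrictMonoOn φ K) {p q : β} (h : IsGap (φ '' K) p q) :
    ∃ a b, φ a = p ∧ φ b = q ∧ IsGap K a b := by
  obtain ⟨a, ha, rfl⟩ := h.left_mem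
  obtain ⟨b, hb, rfl⟩ := h.right_mem
  refine ⟨a, b, rfl, rfl, (hφ.lt_iff_lt ha hb).1 h.lt, ha, hb, fun z hz => ?_⟩
  exact (h.le_or_le _ (mem_image_of_mem φ hz)).imp (hφ.le_iff_le hz ha).1 (hφ.le_iff_le hb hz).1

theorem IsGap.neg [AddCommGroup α] [IsOrderedAddMonoid α] {K : Set α} {a b : α}
    (h : IsGap K a b) : IsGap (-K) (-b) (-a) :=
  ⟨neg_lt_neg h.lt, by simpa using h.right_mem, by simpa using h.left_mem, fun z hz =>
    (h.le_or_le (-z) hz).symm.imp le_neg_of_le_neg neg_le_of_neg_le⟩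

variable [TopologicalSpace α]

theorem isCompact_gapPairs [OrderClosedTopology α] {K : Set α} (hK : IsCompact K) :
    IsCompact (gapPairs K) := by
  have hclosed : IsClosed {p : α × α | ∀ z ∈ K, z ≤ p.1 ∨ p.2 ≤ z} := by
    simp only [ofPred_forall, ofPred_or]
    exact isClosed_biInter fun z _ => (isClosed_le continuous_const continuous_fst).union
      (isClosed_le continuous_snd continuous_const)
  exact (hK.prod hK).inter_right hclosed

theorem exists_isGap_of_notMem [OrderClosedTopology α] {K : Set α} (hK : IsCompact K)
    {u y v : α} (hu : u ∈ K) (hv : v ∈ K) (hy : y ∉ K) (huy : u ≤ y) (hyv : y ≤ v) :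
    ∃ a b, IsGap K a b ∧ u ≤ a ∧ y ∈ Ioo a b ∧ b ≤ v := by
  obtain ⟨a, ⟨haK, hay⟩, ha⟩ :=
    (hK.inter_right (isClosed_Iic (a := y))).exists_isGreatest ⟨u, hu, huy⟩
  obtain ⟨b, ⟨hbK, hyb⟩, hb⟩ :=
    (hK.inter_right (isClosed_Ici (a := y))).exists_isLeast ⟨v, hv, hyv⟩
  have hay' : a < y := hay.lt_of_ne (ne_of_mem_of_not_mem haK hy)
  have hyb' : y < b := hyb.lt_of_ne' (ne_of_mem_of_not_mem hbK hy)
  exact ⟨a, b, ⟨hay'.trans hyb', haK, hbK, fun z hz =>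
    (le_total z y).imp (fun h => ha ⟨hz, h⟩) fun h => hb ⟨hz, h⟩⟩, ha ⟨hu, huy⟩, ⟨hay', hyb'⟩,
    hb ⟨hv, hyv⟩⟩

theorem exists_isGap_of_interior_eq_empty [OrderClosedTopology α] [DenselyOrdered α] {K : Set α}
    (hK : IsCompact K) (hint : interior K = ∅) {u v : α} (hu : u ∈ K) (hv : v ∈ K)
    (huv : u < v) : ∃ a b, IsGap K a b ∧ u ≤ a ∧ b ≤ v := by
  obtain ⟨y, hy, hyK⟩ : ∃ y ∈ Ioo u v, y ∉ K := by
    by_contra! hsub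
    have hIoo : Ioo u v ⊆ interior K := interior_maximal hsub isOpen_Ioo
    exact (nonempty_Ioo.2 huv).not_subset_empty (hint ▸ hIoo)
  obtain ⟨a, b, hab, hua, -, hbv⟩ := exists_isGap_of_notMem hK hu hv hyK hy.1.le hy.2.le
  exact ⟨a, b, hab, hua, hbv⟩

end Gaps

theorem exists_longest_isGap {K : Set ℝ} (hK : IsCompact K) {l r a b : ℝ} (hab : IsGap K a b)
    (hla : l ≤ a) (hbr : b ≤ r) :
    ∃ a' b', IsGap K a' b' ∧ l ≤ a' ∧ b' ≤ r ∧
      ∀ u v, IsGap K u v → l ≤ u → v ≤ r → v - u ≤ b' - a' := by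
  have hcompact : IsCompact (gapPairs K ∩ {p | l ≤ p.1 ∧ p.2 ≤ r}) :=
    (isCompact_gapPairs hK).inter_right
      ((isClosed_le continuous_const continuous_fst).inter
        (isClosed_le continuous_snd continuous_const))
  obtain ⟨⟨a', b'⟩, ⟨hpair, hla', hbr'⟩, hmax⟩ :=
    hcompact.exists_isMaxOn (f := fun p => p.2 - p.1) ⟨(a, b), (isGap_iff.1 hab).2, hla, hbr⟩
      (by fun_prop)
  have hlongest : ∀ u v, IsGap K u v → l ≤ u → v ≤ r → v - u ≤ b' - a' := fun u v huv hlu hvr =>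
    isMaxOn_iff.1 hmax (u, v) ⟨(isGap_iff.1 huv).2, hlu, hvr⟩
  have hlt : a' < b' := by linarith [hlongest a b hab hla hbr, hab.lt]
  exact ⟨a', b', isGap_iff.2 ⟨hlt, hpair⟩, hla', hbr', hlongest⟩

section LinkedGaps

/-- A gap `(a, b)` of `K₁` and a gap `(c, e)` of `K₂` are linked, `K₁` being on the left: each of
the two intervals contains exactly one endpoint of the other. -/
structure LinkedGaps (K₁ K₂ : Set ℝ) (a b c e : ℝ) : Prop where
  fst : IsGap K₁ a b
  snd : IsGap K₂ c e
  left_lt : a < c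
  lt : c < b
  lt_right : b < e

variable {K₁ K₂ : Set ℝ}

theorem exists_linkedGaps (hK₁ : IsCompact K₁) (hK₂ : IsCompact K₂) (hdisj : Disjoint K₁ K₂)
    {p₁ q₁ p₂ q₂ : ℝ} (hp₁ : p₁ ∈ K₁) (hq₁ : q₁ ∈ K₁) (hp₂ : p₂ ∈ K₂) (hq₂ : q₂ ∈ K₂)
    (hp : p₁ < p₂) (hpq : p₂ < q₁) (hq : q₁ < q₂) : ∃ a b c e, LinkedGaps K₁ K₂ a b c e := by
  obtain ⟨c, e, hce, hpc, ⟨hcq, hqe⟩, -⟩ :=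
    exists_isGap_of_notMem hK₂ hp₂ hq₂ (disjoint_left.1 hdisj hq₁) hpq.le hq.le
  obtain ⟨a, b, hab, -, ⟨hac, hcb⟩, hbq⟩ := exists_isGap_of_notMem hK₁ hp₁ hq₁
    (disjoint_right.1 hdisj hce.left_mem) (hp.le.trans hpc) hcq.le
  exact ⟨a, b, c, e, hab, hce, hac, hcb, hbq.trans_lt hqe⟩

theorem LinkedGaps.exists_shortest (hK₁ : IsCompact K₁) (hK₂ : IsCompact K₂)
    (hdisj : Disjoint K₁ K₂) {a b c e : ℝ} (h : LinkedGaps K₁ K₂ a b c e) :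
    ∃ a' b' c' e', LinkedGaps K₁ K₂ a' b' c' e' ∧ ∀ u v w z, LinkedGaps K₁ K₂ u v w z →
      (b' - a') + (e' - c') ≤ (v - u) + (z - w) := by
  let S : Set ((ℝ × ℝ) × (ℝ × ℝ)) := (gapPairs K₁ ×ˢ gapPairs K₂) ∩
    {p | p.1.1 ≤ p.2.1 ∧ p.2.1 ≤ p.1.2 ∧ p.1.2 ≤ p.2.2}
  have hS : IsCompact S := by
    have hclosed : IsClosed
        {p : (ℝ × ℝ) × (ℝ × ℝ) | p.1.1 ≤ p.2.1 ∧ p.2.1 ≤ p.1.2 ∧ p.1.2 ≤ p.2.2} := by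
      refine (isClosed_le ?_ ?_).and ((isClosed_le ?_ ?_).and (isClosed_le ?_ ?_)) <;> fun_prop
    exact ((isCompact_gapPairs hK₁).prod (isCompact_gapPairs hK₂)).inter_right hclosed
  have mem_S : ∀ {u v w z}, LinkedGaps K₁ K₂ u v w z → ((u, v), (w, z)) ∈ S := fun h =>
    ⟨⟨(isGap_iff.1 h.fst).2, (isGap_iff.1 h.snd).2⟩, h.left_lt.le, h.lt.le, h.lt_right.le⟩
  obtain ⟨⟨⟨a', b'⟩, c', e'⟩, ⟨⟨hab, hce⟩, hac, hcb, hbe⟩, hmin⟩ :=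
    hS.exists_isMinOn (f := fun p => (p.1.2 - p.1.1) + (p.2.2 - p.2.1)) ⟨_, mem_S h⟩ (by fun_prop)
  have ne : ∀ {u v}, u ∈ K₁ → v ∈ K₂ → u ≠ v := fun hu hv => hdisj.ne_of_mem hu hv
  have hac' : a' < c' := hac.lt_of_ne (ne hab.1.1 hce.1.1)
  have hcb' : c' < b' := hcb.lt_of_ne' (ne hab.1.2 hce.1.1)
  have hbe' : b' < e' := hbe.lt_of_ne (ne hab.1.2 hce.1.2)
  refine ⟨a', b', c', e', ⟨isGap_iff.2 ⟨hac'.trans hcb', hab⟩, isGap_iff.2 ⟨hcb'.trans hbe', hce⟩,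
    hac', hcb', hbe'⟩, fun u v w z huvwz => ?_⟩
  exact isMinOn_iff.1 hmin _ (mem_S huvwz)

end LinkedGaps

/-- A compact subset `K` of the line has Newhouse thickness at least `τ`: of any two gaps of `K`,
one has length at most `1 / τ` times the distance between them, and every gap has length at most
`1 / τ` times its distance to either unbounded component of the complement of `K`; that the latter
distance is large is witnessed by a point of `K`. -/
structure IsThick (K : Set ℝ) (τ : ℝ) : Prop where
  sep : ∀ a b c e, IsGap K a b → IsGap K c e → b ≤ c → τ * (b - a) ≤ c - b ∨ τ * (e - c) ≤ c - b
  left : ∀ a b, IsGap K a b → ∃ z ∈ K, τ * (b - a) ≤ a - z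
  right : ∀ a b, IsGap K a b → ∃ z ∈ K, τ * (b - a) ≤ z - b

section Thick

variable {K : Set ℝ} {τ : ℝ}

theorem isThick_of_ordConnected (hK : K.OrdConnected) (τ : ℝ) : IsThick K τ := by
  have not_isGap : ∀ a b, ¬ IsGap K a b := by
    intro a b hab
    have hlt := hab.lt
    have hmem : (a + b) / 2 ∈ K :=
      hK.out hab.left_mem hab.right_mem ⟨by linarith, by linarith⟩
    rcases hab.le_or_le _ hmem with h | h <;> linarith
  exact ⟨fun a b _ _ hab => absurd hab (not_isGap a b),
    fun a b hab => absurd hab (not_isGap a b), fun a b hab => absurd hab (not_isGap a b)⟩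

theorem IsThick.neg (h : IsThick K τ) : IsThick (-K) τ := by
  have gap_neg : ∀ {a b}, IsGap (-K) a b → IsGap K (-b) (-a) := fun hab => by
    simpa only [neg_neg] using hab.neg
  refine ⟨fun a b c e hab hce hbc => ?_, fun a b hab => ?_, fun a b hab => ?_⟩
  · have hsep := h.sep _ _ _ _ (gap_neg hce) (gap_neg hab) (neg_le_neg hbc)
    simpa only [neg_sub_neg] using hsep.symm
  · obtain ⟨z, hz, hle⟩ := h.right _ _ (gap_neg hab)
    exact ⟨-z, by simpa using hz, by linarith⟩
  · obtain ⟨z, hz, hle⟩ := h.left _ _ (gap_neg hab)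
    exact ⟨-z, by simpa using hz, by linarith⟩

theorem IsThick.image_of_strictMonoOn (h : IsThick K τ) (hτ : 0 ≤ τ) {τ' : ℝ} {φ : ℝ → ℝ}
    (hφ : StrictMonoOn φ K)
    (hscale : ∀ u ∈ K, ∀ v ∈ K, ∀ w ∈ K, ∀ z ∈ K,
      τ * |v - u| ≤ |z - w| → τ' * |φ v - φ u| ≤ |φ z - φ w|) :
    IsThick (φ '' K) τ' := by
  have scale : ∀ {u v w z}, IsGap K u v → w ∈ K → z ∈ K → τ * (v - u) ≤ z - w →
      τ' * (φ v - φ u) ≤ φ z - φ w := by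
    intro u v w z huv hw hz hle
    have huv_nonneg : 0 ≤ v - u := sub_nonneg.2 huv.lt.le
    have hwz_nonneg : 0 ≤ z - w := (mul_nonneg hτ huv_nonneg).trans hle
    have hφuv := hφ huv.left_mem huv.right_mem huv.lt
    have hφwz := (hφ.le_iff_le hw hz).2 (sub_nonneg.1 hwz_nonneg)
    have := hscale u huv.left_mem v huv.right_mem w hw z hz
    rw [abs_of_nonneg huv_nonneg, abs_of_nonneg hwz_nonneg, abs_of_pos (sub_pos.2 hφuv),
      abs_of_nonneg (sub_nonneg.2 hφwz)] at this
    exact this hle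
  refine ⟨fun _ _ _ _ hpq hrs hqr => ?_, fun _ _ hpq => ?_, fun _ _ hpq => ?_⟩
  · obtain ⟨a, b, rfl, rfl, hab⟩ := hpq.exists_of_image hφ
    obtain ⟨c, e, rfl, rfl, hce⟩ := hrs.exists_of_image hφ
    have hbc : b ≤ c := (hφ.le_iff_le hab.right_mem hce.left_mem).1 hqr
    exact (h.sep a b c e hab hce hbc).imp (scale hab hab.right_mem hce.left_mem)
      (scale hce hab.right_mem hce.left_mem)
  · obtain ⟨a, b, rfl, rfl, hab⟩ := hpq.exists_of_image hφ
    obtain ⟨z, hz, hle⟩ := h.left a b hab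
    exact ⟨φ z, mem_image_of_mem φ hz, scale hab hz hab.left_mem hle⟩
  · obtain ⟨a, b, rfl, rfl, hab⟩ := hpq.exists_of_image hφ
    obtain ⟨z, hz, hle⟩ := h.right a b hab
    exact ⟨φ z, mem_image_of_mem φ hz, scale hab hab.right_mem hz hle⟩

theorem IsThick.image_of_strictAntiOn (h : IsThick K τ) (hτ : 0 ≤ τ) {τ' : ℝ} {φ : ℝ → ℝ}
    (hφ : StrictAntiOn φ K)
    (hscale : ∀ u ∈ K, ∀ v ∈ K, ∀ w ∈ K, ∀ z ∈ K,
      τ * |v - u| ≤ |z - w| → τ' * |φ v - φ u| ≤ |φ z - φ w|) :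
    IsThick (φ '' K) τ' := by
  have hneg : IsThick ((fun t => -φ t) '' K) τ' := by
    refine h.image_of_strictMonoOn hτ hφ.neg fun u hu v hv w hw z hz hle => ?_
    simpa only [neg_sub_neg, abs_sub_comm] using hscale u hu v hv w hw z hz hle
  simpa only [← image_neg_eq_neg, image_image, neg_neg] using hneg.neg

theorem IsThick.lt_of_le (h : IsThick K τ) (hτ : 0 < τ) {a b c e : ℝ} (hab : IsGap K a b)
    (hce : IsGap K c e) (hbc : b ≤ c) : b < c := by
  have hab_pos : 0 < τ * (b - a) := mul_pos hτ (sub_pos.2 hab.lt)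
  have hce_pos : 0 < τ * (e - c) := mul_pos hτ (sub_pos.2 hce.lt)
  rcases h.sep a b c e hab hce hbc with hle | hle <;> linarith

theorem IsThick.exists_shorter_isGap_right (hK : IsCompact K) (h : IsThick K τ) (hτ : 0 < τ)
    {a b y : ℝ} (hab : IsGap K a b) (hy : y ∉ K) (hby : b < y) (hyb : y - b < τ * (b - a)) :
    ∃ a' b', IsGap K a' b' ∧ b ≤ a' ∧ y ∈ Ioo a' b' ∧ b' - a' < b - a := by
  obtain ⟨z, hz, hle⟩ := h.right a b hab
  obtain ⟨a', b', hab', hba', hy', -⟩ :=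
    exists_isGap_of_notMem hK hab.right_mem hz hy hby.le (by linarith)
  refine ⟨a', b', hab', hba', hy', lt_of_mul_lt_mul_left ?_ hτ.le⟩
  rcases h.sep a b a' b' hab hab' hba' with hle' | hle' <;> linarith [hy'.1]

theorem IsThick.exists_shorter_isGap_left (hK : IsCompact K) (h : IsThick K τ) (hτ : 0 < τ)
    {a b y : ℝ} (hab : IsGap K a b) (hy : y ∉ K) (hya : y < a) (hay : a - y < τ * (b - a)) :
    ∃ a' b', IsGap K a' b' ∧ b' ≤ a ∧ y ∈ Ioo a' b' ∧ b' - a' < b - a := by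
  obtain ⟨a', b', hab', hle, ⟨hlt₁, hlt₂⟩, hshort⟩ := h.neg.exists_shorter_isGap_right hK.neg hτ
    hab.neg (y := -y) (by simpa using hy) (neg_lt_neg hya) (by linarith)
  refine ⟨-b', -a', by simpa only [neg_neg] using hab'.neg, by linarith,
    ⟨by linarith, by linarith⟩, by linarith⟩

end Thick

section GapLemma

variable {K₁ K₂ : Set ℝ} {τ₁ τ₂ : ℝ}

theorem LinkedGaps.exists_shorter (hK₁ : IsCompact K₁) (hK₂ : IsCompact K₂) (h₁ : IsThick K₁ τ₁)
    (h₂ : IsThick K₂ τ₂) (hτ₁ : 0 < τ₁) (hτ₂ : 0 < τ₂) (hτ : 1 < τ₁ * τ₂)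
    (hdisj : Disjoint K₁ K₂) {a b c e : ℝ} (h : LinkedGaps K₁ K₂ a b c e) :
    ∃ c' e' a' b', LinkedGaps K₂ K₁ c' e' a' b' ∧
      (e' - c') + (b' - a') < (b - a) + (e - c) := by
  obtain ⟨hab, hce, hac, hcb, hbe⟩ := h
  -- The endpoint `e` is close to `(a, b)` or the endpoint `a` is close to `(c, e)`: otherwise the
  -- lengths satisfy `τ₁ (b - a) < e - c` and `τ₂ (e - c) < b - a`, contradicting `1 < τ₁ τ₂`.
  have hclose : e - b < τ₁ * (b - a) ∨ c - a < τ₂ * (e - c) := by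
    by_contra! hfar
    have hce_pos : 0 < e - c := sub_pos.2 hce.lt
    have : e - c < e - c := calc
      e - c < τ₁ * τ₂ * (e - c) := lt_mul_of_one_lt_left hce_pos hτ
      _ = τ₁ * (τ₂ * (e - c)) := mul_assoc τ₁ τ₂ (e - c)
      _ ≤ τ₁ * (b - a) := mul_le_mul_of_nonneg_left (by linarith) hτ₁.le
      _ < e - c := by linarith
    exact this.false
  rcases hclose with hclose | hclose
  · obtain ⟨a', b', hab', hba', ⟨hae, heb⟩, hshort⟩ := h₁.exists_shorter_isGap_right hK₁ hτ₁ hab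
      (disjoint_right.1 hdisj hce.right_mem) hbe hclose
    exact ⟨c, e, a', b', ⟨hce, hab', hcb.trans_le hba', hae, heb⟩, by linarith⟩
  · obtain ⟨c', e', hce', hec', ⟨hca, hae⟩, hshort⟩ := h₂.exists_shorter_isGap_left hK₂ hτ₂ hce
      (disjoint_left.1 hdisj hab.left_mem) hac hclose
    exact ⟨c', e', a, b, ⟨hce', hab, hca, hae, hec'.trans_lt hcb⟩, by linarith⟩

theorem IsThick.inter_nonempty (hK₁ : IsCompact K₁) (hK₂ : IsCompact K₂) (h₁ : IsThick K₁ τ₁)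
    (h₂ : IsThick K₂ τ₂) (hτ₁ : 0 < τ₁) (hτ₂ : 0 < τ₂) (hτ : 1 < τ₁ * τ₂) {p₁ q₁ p₂ q₂ : ℝ}
    (hp₁ : p₁ ∈ K₁) (hq₁ : q₁ ∈ K₁) (hp₂ : p₂ ∈ K₂) (hq₂ : q₂ ∈ K₂) (hp : p₁ < p₂)
    (hpq : p₂ < q₁) (hq : q₁ < q₂) : (K₁ ∩ K₂).Nonempty := by
  rw [← not_disjoint_iff_nonempty_inter]
  intro hdisj
  obtain ⟨_, _, _, _, hlinked⟩ := exists_linkedGaps hK₁ hK₂ hdisj hp₁ hq₁ hp₂ hq₂ hp hpq hq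
  obtain ⟨a, b, c, e, hshortest, hmin⟩ := hlinked.exists_shortest hK₁ hK₂ hdisj
  -- Shortening exchanges the roles of `K₁` and `K₂`, so it is applied twice.
  obtain ⟨c', e', a', b', hswapped, hlt⟩ :=
    hshortest.exists_shorter hK₁ hK₂ h₁ h₂ hτ₁ hτ₂ hτ hdisj
  obtain ⟨u, v, w, z, hshorter, hlt'⟩ :=
    hswapped.exists_shorter hK₂ hK₁ h₂ h₁ hτ₂ hτ₁ (by rwa [mul_comm]) hdisj.symm
  linarith [hmin u v w z hshorter]

theorem IsThick.interior_add_nonempty (hK₁ : IsCompact K₁) (hK₂ : IsCompact K₂)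
    (hn₁ : K₁.Nontrivial) (hn₂ : K₂.Nontrivial) (h₁ : IsThick K₁ τ₁) (h₂ : IsThick K₂ τ₂)
    (hτ₁ : 0 < τ₁) (hτ₂ : 0 < τ₂) (hτ : 1 < τ₁ * τ₂) : (interior (K₁ + K₂)).Nonempty := by
  obtain ⟨p₁, hp₁, q₁, hq₁, hpq₁⟩ := hn₁.exists_lt
  obtain ⟨p₂, hp₂, q₂, hq₂, hpq₂⟩ := hn₂.exists_lt
  have hsub : Ioo (p₁ + p₂) (min (p₁ + q₂) (q₁ + p₂)) ⊆ K₁ + K₂ := by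
    rintro t ⟨hpt, htq⟩
    obtain ⟨ht₁, ht₂⟩ := lt_min_iff.1 htq
    have hreflected : IsThick ((t - ·) '' K₁) τ₁ :=
      h₁.image_of_strictAntiOn hτ₁.le (fun u _ v _ huv => sub_lt_sub_left huv t)
        fun u _ v _ w _ z _ hle => by simpa only [sub_sub_sub_cancel_left, abs_sub_comm] using hle
    obtain ⟨_, ⟨y₁, hy₁, rfl⟩, hy₂⟩ := hreflected.inter_nonempty
      (hK₁.image (f := (t - ·)) (by fun_prop)) hK₂ h₂ hτ₁ hτ₂ hτ
      (mem_image_of_mem (t - ·) hq₁) (mem_image_of_mem (t - ·) hp₁) hp₂ hq₂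
      (by linarith) (by linarith) (by linarith)
    exact ⟨y₁, hy₁, t - y₁, hy₂, add_sub_cancel y₁ t⟩
  have hlt : p₁ + p₂ < min (p₁ + q₂) (q₁ + p₂) := lt_min (by linarith) (by linarith)
  exact (nonempty_Ioo.2 hlt).mono (interior_maximal hsub isOpen_Ioo)

end GapLemma

/-- `A` contains a compact set with at least two points whose Newhouse thickness is at least `τ`.
This is all that the gap lemma needs in order to find an open interval in a sumset. -/
def ContainsThick (A : Set ℝ) (τ : ℝ) : Prop :=
  ∃ L ⊆ A, IsCompact L ∧ L.Nontrivial ∧ IsThick L τ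

theorem ContainsThick.mono {A B : Set ℝ} {τ : ℝ} (h : ContainsThick A τ) (hAB : A ⊆ B) :
    ContainsThick B τ :=
  let ⟨L, hLA, hL⟩ := h
  ⟨L, hLA.trans hAB, hL⟩

theorem ContainsThick.interior_add_nonempty {A B : Set ℝ} {τ₁ τ₂ : ℝ} (hA : ContainsThick A τ₁)
    (hB : ContainsThick B τ₂) (hτ₁ : 0 < τ₁) (hτ₂ : 0 < τ₂) (hτ : 1 < τ₁ * τ₂) :
    (interior (A + B)).Nonempty := by
  obtain ⟨K₁, hsub₁, hK₁, hn₁, h₁⟩ := hA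
  obtain ⟨K₂, hsub₂, hK₂, hn₂, h₂⟩ := hB
  exact (h₁.interior_add_nonempty hK₁ hK₂ hn₁ hn₂ h₂ hτ₁ hτ₂ hτ).mono
    (interior_mono (add_subset_add hsub₁ hsub₂))

section Localization

variable {K : Set ℝ} {τ : ℝ}

theorem IsThick.inter_Icc (h : IsThick K τ) (hτ : 0 ≤ τ) {a b c e : ℝ} (hab : IsGap K a b)
    (hce : IsGap K c e) (hbc : b ≤ c)
    (hlong : ∀ u v, IsGap K u v → b ≤ u → v ≤ c → v - u ≤ b - a ∧ v - u ≤ e - c) :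
    IsThick (K ∩ Icc b c) τ := by
  refine ⟨fun u v w z huv hwz hvw => ?_, fun u v huv => ?_, fun u v huv => ?_⟩
  · exact h.sep u v w z (huv.of_inter_ordConnected ordConnected_Icc)
      (hwz.of_inter_ordConnected ordConnected_Icc) hvw
  · have huv' := huv.of_inter_ordConnected ordConnected_Icc
    have hbu : b ≤ u := huv.left_mem.2.1
    have hle := mul_le_mul_of_nonneg_left (hlong u v huv' hbu huv.right_mem.2.2).1 hτ
    exact ⟨b, ⟨hab.right_mem, left_mem_Icc.2 hbc⟩, (h.sep a b u v hab huv' hbu).elim hle.trans id⟩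
  · have huv' := huv.of_inter_ordConnected ordConnected_Icc
    have hvc : v ≤ c := huv.right_mem.2.2
    have hle := mul_le_mul_of_nonneg_left (hlong u v huv' huv.left_mem.2.1 hvc).2 hτ
    exact ⟨c, ⟨hce.left_mem, right_mem_Icc.2 hbc⟩, (h.sep u v c e huv' hce hvc).elim id hle.trans⟩

theorem IsThick.exists_mem_Ioo_left (hK : IsCompact K) (h : IsThick K τ) (hτ : 0 < τ) {a b : ℝ}
    (hab : IsGap K a b) {ε : ℝ} (hε : 0 < ε) : ∃ z ∈ K, z ∈ Ioo (a - ε) a := by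
  obtain ⟨δ, hδ, hδ_lt⟩ := exists_between (lt_min hε (mul_pos hτ (sub_pos.2 hab.lt)))
  obtain ⟨hδε, hδab⟩ := lt_min_iff.1 hδ_lt
  by_cases hmem : a - δ ∈ K
  · exact ⟨a - δ, hmem, by linarith, by linarith⟩
  · obtain ⟨a', b', hab', hb'a, hδ', -⟩ :=
      h.exists_shorter_isGap_left hK hτ hab hmem (by linarith) (by linarith)
    exact ⟨b', hab'.right_mem, by linarith [hδ'.2], h.lt_of_le hτ hab' hab hb'a⟩

theorem IsThick.exists_isGap_left (hK : IsCompact K) (hint : interior K = ∅) (h : IsThick K τ)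
    (hτ : 0 < τ) {a b : ℝ} (hab : IsGap K a b) {ε : ℝ} (hε : 0 < ε) :
    ∃ u v, IsGap K u v ∧ a - ε ≤ u ∧ v ≤ a := by
  obtain ⟨z, hz, hεz, hza⟩ := h.exists_mem_Ioo_left hK hτ hab hε
  obtain ⟨u, v, huv, hzu, hva⟩ :=
    exists_isGap_of_interior_eq_empty hK hint hz hab.left_mem hza
  exact ⟨u, v, huv, hεz.le.trans hzu, hva⟩

theorem IsThick.containsThick_inter_Icc_left (hK : IsCompact K) (hint : interior K = ∅)
    (h : IsThick K τ) (hτ : 0 < τ) {a b : ℝ} (hab : IsGap K a b) {ε : ℝ} (hε : 0 < ε) :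
    ContainsThick (K ∩ Icc (a - ε) a) τ := by
  -- The piece of `K` between the longest gap `(a₁, b₁)` in `[a - ε, a]` and the longest gap
  -- `(c, e)` in `[b₁, a]` is as thick as `K`, because each of its gaps is no longer than these two.
  obtain ⟨u, v, huv, hεu, hva⟩ := h.exists_isGap_left hK hint hτ hab hε
  obtain ⟨a₁, b₁, h₁, hεa₁, hb₁a, hlongest₁⟩ := exists_longest_isGap hK huv hεu hva
  obtain ⟨u', v', huv', hbu', hva'⟩ := exists_isGap_of_interior_eq_empty hK hint h₁.right_mem
    hab.left_mem (h.lt_of_le hτ h₁ hab hb₁a)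
  obtain ⟨c, e, hce, hb₁c, hea, hlongest₂⟩ := exists_longest_isGap hK huv' hbu' hva'
  have hεb₁ : a - ε ≤ b₁ := hεa₁.trans h₁.lt.le
  have hca : c ≤ a := hce.lt.le.trans hea
  refine ⟨K ∩ Icc b₁ c, inter_subset_inter_right K (Icc_subset_Icc hεb₁ hca),
    hK.inter_right isClosed_Icc, ⟨b₁, ⟨h₁.right_mem, left_mem_Icc.2 hb₁c⟩, c,
      ⟨hce.left_mem, right_mem_Icc.2 hb₁c⟩, (h.lt_of_le hτ h₁ hce hb₁c).ne⟩, ?_⟩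
  exact h.inter_Icc hτ.le h₁ hce hb₁c fun p q hpq hbp hqc =>
    ⟨hlongest₁ p q hpq (hεb₁.trans hbp) (hqc.trans hca), hlongest₂ p q hpq hbp (hqc.trans hca)⟩

end Localization

section Squares

variable {x y ε : ℝ}

theorem abs_sq_sub_sq_bounds {u v : ℝ} (hu : u ∈ Icc (y - ε) (y + ε))
    (hv : v ∈ Icc (y - ε) (y + ε)) :
    2 * (|y - x| - ε) * |v - u| ≤ |(v - x) ^ 2 - (u - x) ^ 2| ∧
      |(v - x) ^ 2 - (u - x) ^ 2| ≤ 2 * (|y - x| + ε) * |v - u| := by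
  have hfactor : (v - x) ^ 2 - (u - x) ^ 2 = (u + v - 2 * x) * (v - u) := by ring
  have hclose : |(u + v - 2 * x) - 2 * (y - x)| ≤ 2 * ε :=
    abs_le.2 ⟨by linarith [hu.1, hv.1], by linarith [hu.2, hv.2]⟩
  have hdouble : |2 * (y - x)| = 2 * |y - x| := by rw [abs_mul, abs_two]
  have hdiff := abs_le.1 ((abs_abs_sub_abs_le (u + v - 2 * x) (2 * (y - x))).trans hclose)
  rw [hfactor, abs_mul]
  exact ⟨mul_le_mul_of_nonneg_right (by linarith [hdiff.1]) (abs_nonneg _),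
    mul_le_mul_of_nonneg_right (by linarith [hdiff.2]) (abs_nonneg _)⟩

theorem injOn_sub_sq (hε : ε < |y - x|) :
    InjOn (fun t => (t - x) ^ 2) (Icc (y - ε) (y + ε)) := by
  intro v hv u hu heq
  have hle := (abs_sq_sub_sq_bounds (x := x) hu hv).1
  rw [sub_eq_zero.2 heq, abs_zero] at hle
  exact sub_eq_zero.1 (abs_nonpos_iff.1 (nonpos_of_mul_nonpos_right hle (by linarith)))

theorem IsThick.image_sub_sq {L : Set ℝ} {τ τ' : ℝ} (h : IsThick L τ) (hτ : 0 ≤ τ) (hτ' : 0 ≤ τ')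
    (hL : L ⊆ Icc (y - ε) (y + ε)) (hε : 0 ≤ ε) (hεx : ε < |y - x|)
    (hle : (|y - x| + ε) * τ' ≤ (|y - x| - ε) * τ) :
    IsThick ((fun t => (t - x) ^ 2) '' L) τ' := by
  have hscale : ∀ u ∈ L, ∀ v ∈ L, ∀ w ∈ L, ∀ z ∈ L, τ * |v - u| ≤ |z - w| →
      τ' * |(v - x) ^ 2 - (u - x) ^ 2| ≤ |(z - x) ^ 2 - (w - x) ^ 2| := by
    intro u hu v hv w hw z hz huvwz
    calc τ' * |(v - x) ^ 2 - (u - x) ^ 2|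
        ≤ τ' * (2 * (|y - x| + ε) * |v - u|) :=
          mul_le_mul_of_nonneg_left (abs_sq_sub_sq_bounds (hL hu) (hL hv)).2 hτ'
      _ = 2 * ((|y - x| + ε) * τ') * |v - u| := by ring
      _ ≤ 2 * ((|y - x| - ε) * τ) * |v - u| := by gcongr
      _ = 2 * (|y - x| - ε) * (τ * |v - u|) := by ring
      _ ≤ 2 * (|y - x| - ε) * |z - w| := mul_le_mul_of_nonneg_left huvwz (by linarith)
      _ ≤ |(z - x) ^ 2 - (w - x) ^ 2| := (abs_sq_sub_sq_bounds (hL hw) (hL hz)).1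
  have hcont : ContinuousOn (fun t => (t - x) ^ 2) (Icc (y - ε) (y + ε)) := by fun_prop
  rcases hcont.strictMonoOn_of_injOn_Icc' (by linarith) (injOn_sub_sq hεx) with hmono | hanti
  · exact h.image_of_strictMonoOn hτ (hmono.mono hL) hscale
  · exact h.image_of_strictAntiOn hτ (hanti.mono hL) hscale

theorem IsThick.containsThick_image_sub_sq {K : Set ℝ} {τ τ' : ℝ} (hK : IsCompact K)
    (hint : interior K = ∅) (h : IsThick K τ) (hgap : ∃ a b, IsGap K a b) (hτ' : 0 < τ')
    (hlt : τ' < τ) (x : ℝ) : ContainsThick ((fun t => (t - x) ^ 2) '' K) τ' := by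
  have hτ : 0 < τ := hτ'.trans hlt
  obtain ⟨y, b, hyb, hyx⟩ : ∃ y b, IsGap K y b ∧ y ≠ x := by
    obtain ⟨a, b, hab⟩ := hgap
    obtain ⟨u, v, huv, -, hva⟩ := h.exists_isGap_left hK hint hτ hab one_pos
    rcases eq_or_ne a x with rfl | hax
    · exact ⟨u, v, huv, (huv.lt.trans_le hva).ne⟩
    · exact ⟨a, b, hab, hax⟩
  have hdist : 0 < |y - x| := abs_pos.2 (sub_ne_zero.2 hyx)
  -- The radius for which the slopes of `(t - x) ^ 2` on `[y - ε, y + ε]` have extremal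
  -- quotient `(|y - x| - ε) / (|y - x| + ε) = τ' / τ`.
  set ε := |y - x| * (τ - τ') / (τ + τ') with hε_def
  have hε : 0 < ε := div_pos (mul_pos hdist (sub_pos.2 hlt)) (add_pos hτ hτ')
  have hratio : (|y - x| + ε) * τ' = (|y - x| - ε) * τ := by rw [hε_def]; field_simp; ring
  have hεx : ε < |y - x| := by
    rw [← sub_pos]
    exact pos_of_mul_pos_left (hratio ▸ by positivity) hτ.le
  obtain ⟨L, hL, hLc, hLn, hLτ⟩ := h.containsThick_inter_Icc_left hK hint hτ hyb hε
  have hLy : L ⊆ Icc (y - ε) (y + ε) := fun t ht =>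
    ⟨(hL ht).2.1, (hL ht).2.2.trans (by linarith)⟩
  exact ⟨_, image_mono fun t ht => (hL ht).1, hLc.image (by fun_prop),
    hLn.image_of_injOn ((injOn_sub_sq hεx).mono hLy),
    hLτ.image_sub_sq hτ.le hτ'.le hLy hε.le hεx hratio.le⟩

end Squares

section PinnedDistances

theorem pinnedDistanceSet_eq_image_dist {E : Type*} [NormedAddCommGroup E] (x : E) (C : Set E) :
    pinnedDistanceSet x C = dist x '' C := by
  ext t
  simp only [pinnedDistanceSet, mem_ofPred_eq, mem_image, dist_eq_norm, eq_comm]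

variable {E : Type*} [NormedAddCommGroup E] [NormedSpace ℝ E] {x q : E}

theorem exists_ray (h : q ≠ x) :
    ∃ γ : ℝ → E, Continuous γ ∧ γ (dist x q) = q ∧ ∀ r, 0 ≤ r → dist x (γ r) = r := by
  have hdist : dist x q ≠ 0 := dist_ne_zero.2 h.symm
  refine ⟨fun r => AffineMap.lineMap x q (r / dist x q), by fun_prop, ?_, fun r hr => ?_⟩
  · simp only [div_self hdist, AffineMap.lineMap_apply_one]
  · rw [dist_left_lineMap, Real.norm_of_nonneg (div_nonneg hr dist_nonneg), div_mul_cancel₀ r hdist]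

theorem interior_pinnedDistanceSet_nonempty [Nontrivial E] {C : Set E} (hC : (interior C).Nonempty)
    (x : E) : (interior (pinnedDistanceSet x C)).Nonempty := by
  obtain ⟨p, hp⟩ := hC
  have hinfinite := infinite_of_mem_nhds (X := E) p (isOpen_interior.mem_nhds hp)
  obtain ⟨q, hq, hqx⟩ := hinfinite.nontrivial.exists_ne x
  obtain ⟨γ, hγ, hγq, hdist⟩ := exists_ray hqx
  refine ⟨dist x q, mem_interior_iff_mem_nhds.2 ?_⟩
  have hC_nhds : C ∈ 𝓝 (γ (dist x q)) := by rwa [hγq, ← mem_interior_iff_mem_nhds]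
  rw [pinnedDistanceSet_eq_image_dist]
  filter_upwards [hγ.continuousAt hC_nhds, lt_mem_nhds (dist_pos.2 hqx.symm)] with r hrC hr
  exact ⟨γ r, hrC, hdist r hr.le⟩

theorem ediam_sphere_eq_ediam_closedBall [Nontrivial E] (x : E) {r : ℝ} (hr : 0 ≤ r) :
    Metric.ediam (Metric.sphere x r) = Metric.ediam (Metric.closedBall x r) := by
  rw [← ENNReal.toReal_eq_toReal_iff' Metric.isBounded_sphere.ediam_ne_top
    Metric.isBounded_closedBall.ediam_ne_top]
  exact (Metric.diam_sphere_eq x hr).trans (Metric.diam_closedBall_eq x hr).symm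

end PinnedDistances

section Thickness

variable {d : ℕ} {C G : Set (EuclideanSpace ℝ (Fin d))}

/-- The union of the unbounded gap of `C` and of the bounded gaps other than `G` whose diameter is
at least that of `G`: the set whose distance to `G` enters the definition of the thickness. -/
def largerGaps (C G : Set (EuclideanSpace ℝ (Fin d))) : Set (EuclideanSpace ℝ (Fin d)) :=
  (⋃ H ∈ {H ∈ boundedGaps C | H ≠ G ∧ Metric.ediam G ≤ Metric.ediam H}, H) ∪ unboundedGap C

theorem subset_largerGaps {S : Set (EuclideanSpace ℝ (Fin d))} (hS : IsPathConnected S)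
    (hSC : S ⊆ Cᶜ) (hSG : ¬ S ⊆ G) (hdiam : Metric.ediam G ≤ Metric.ediam S) :
    S ⊆ largerGaps C G := by
  intro z hz
  have hsub : S ⊆ pathComponentIn Cᶜ z := hS.subset_pathComponentIn hz hSC
  by_cases hbdd : Bornology.IsBounded (pathComponentIn Cᶜ z)
  · have hne : pathComponentIn Cᶜ z ≠ G := fun h => hSG (h ▸ hsub)
    exact Or.inl (mem_biUnion ⟨⟨⟨z, hSC hz, rfl⟩, hbdd⟩, hne, hdiam.trans (Metric.ediam_mono hsub)⟩
      (hsub hz))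
  · exact Or.inr ⟨hSC hz, hbdd⟩

theorem setDist_le_edist_of_mem_closure {A B : Set (EuclideanSpace ℝ (Fin d))}
    {p q : EuclideanSpace ℝ (Fin d)} (hp : p ∈ closure A) (hq : q ∈ closure B) :
    setDist A B ≤ edist p q := by
  have hA : ∀ u ∈ A, setDist A B ≤ edist q u := fun u hu => by
    rw [edist_comm]
    calc setDist A B ≤ Metric.infEDist u B := iInf₂_le u hu
      _ = Metric.infEDist u (closure B) := Metric.infEDist_closure.symm
      _ ≤ edist u q := Metric.infEDist_le_edist_of_mem hq
  calc setDist A B ≤ Metric.infEDist q A := Metric.le_infEDist.2 hA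
    _ = Metric.infEDist q (closure A) := Metric.infEDist_closure.symm
    _ ≤ edist q p := Metric.infEDist_le_edist_of_mem hp
    _ = edist p q := edist_comm q p

theorem gapRatioInf_mul_ediam_le (hG : G ∈ boundedGaps C) {p q : EuclideanSpace ℝ (Fin d)}
    (hp : p ∈ closure G) (hq : q ∈ closure (largerGaps C G)) :
    gapRatioInf C * Metric.ediam G ≤ edist p q := by
  have hle : gapRatioInf C ≤ setDist G (largerGaps C G) / Metric.ediam G := iInf₂_le G hG
  exact (ENNReal.mul_le_of_le_div hle).trans (setDist_le_edist_of_mem_closure hp hq)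

theorem boundedGaps_nonempty_of_thickness_ne_zero (hint : ¬ (interior C).Nonempty)
    (h : thickness C ≠ 0) : (boundedGaps C).Nonempty := by
  by_contra hempty
  exact h ((if_neg hempty).trans (if_neg hint))

theorem thickness_eq_gapRatioInf (h : (boundedGaps C).Nonempty) : thickness C = gapRatioInf C :=
  if_pos h

theorem ediam_ne_zero_of_mem_boundedGaps (hd : 1 ≤ d) (hC : IsClosed C) (hG : G ∈ boundedGaps C) :
    Metric.ediam G ≠ 0 := by
  obtain ⟨⟨p, hp, rfl⟩, -⟩ := hG
  have : Nonempty (Fin d) := ⟨⟨0, hd⟩⟩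
  have hmem := (hC.isOpen_compl.pathComponentIn p).mem_nhds (mem_pathComponentIn_self hp)
  exact (Metric.ediam_pos_iff.2 (infinite_of_mem_nhds p hmem).nontrivial).ne'

theorem sphere_subset_largerGaps (hd : 2 ≤ d) {x : EuclideanSpace ℝ (Fin d)} {r : ℝ} (hr : 0 ≤ r)
    (hG : G ⊆ Metric.ball x r) (hdisj : Disjoint (Metric.sphere x r) C) :
    Metric.sphere x r ⊆ largerGaps C G := by
  have : Nonempty (Fin d) := ⟨⟨0, by lia⟩⟩
  have hrank : 1 < Module.rank ℝ (EuclideanSpace ℝ (Fin d)) := by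
    rw [← Module.finrank_eq_rank, finrank_euclideanSpace_fin]
    exact_mod_cast hd
  have hdiam : Metric.ediam G ≤ Metric.ediam (Metric.sphere x r) := by
    rw [ediam_sphere_eq_ediam_closedBall x hr]
    exact Metric.ediam_mono (hG.trans Metric.ball_subset_closedBall)
  refine subset_largerGaps (isPathConnected_sphere hrank x hr) hdisj.subset_compl_right ?_ hdiam
  obtain ⟨p, hp⟩ := NormedSpace.sphere_nonempty (x := x).2 hr
  exact fun hsub => (Metric.mem_ball.1 (hG (hsub hp))).ne (Metric.mem_sphere.1 hp)

theorem mem_pinnedDistanceSet_of_edist_lt (hd : 2 ≤ d) (hG : G ∈ boundedGaps C)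
    {x p q : EuclideanSpace ℝ (Fin d)} {r : ℝ} (hr : 0 ≤ r) (hGr : G ⊆ Metric.ball x r)
    (hp : p ∈ closure G) (hq : q ∈ Metric.sphere x r)
    (hpq : edist p q < gapRatioInf C * Metric.ediam G) : r ∈ pinnedDistanceSet x C := by
  by_contra hrC
  rw [pinnedDistanceSet_eq_image_dist] at hrC
  have hdisj : Disjoint (Metric.sphere x r) C :=
    disjoint_left.2 fun z hz hzC => hrC ⟨z, hzC, Metric.mem_sphere'.1 hz⟩
  have hqlarger := subset_closure (sphere_subset_largerGaps hd hr hGr hdisj hq)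
  exact hpq.not_ge (gapRatioInf_mul_ediam_le hG hp hqlarger)

theorem interior_pinnedDistanceSet_nonempty_of_two_le (hd : 2 ≤ d) (hC : IsClosed C)
    (hgap : (boundedGaps C).Nonempty) (hratio : gapRatioInf C ≠ 0)
    (x : EuclideanSpace ℝ (Fin d)) : (interior (pinnedDistanceSet x C)).Nonempty := by
  obtain ⟨G, hG⟩ := hgap
  have hdiam : Metric.ediam G ≠ 0 := ediam_ne_zero_of_mem_boundedGaps (by lia) hC hG
  obtain ⟨q, hq, hfar⟩ : ∃ q ∈ closure G, IsMaxOn (dist x) (closure G) q :=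
    hG.2.isCompact_closure.exists_isMaxOn
      (closure_nonempty_iff.2 (Metric.ediam_pos_iff.1 (pos_iff_ne_zero.2 hdiam)).nonempty)
      (by fun_prop)
  have hqx : q ≠ x := by
    rintro rfl
    refine hdiam (Metric.ediam_eq_zero_iff.2 (subsingleton_of_subset_singleton (a := q) ?_))
    exact fun p hp => (dist_le_zero.1 ((hfar (subset_closure hp)).trans_eq (dist_self q))).symm
  obtain ⟨γ, hγ, hγq, hdist⟩ := exists_ray hqx
  have hnear : ∀ᶠ r in 𝓝 (dist x q), edist q (γ r) < gapRatioInf C * Metric.ediam G := by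
    have hcont : ContinuousAt (fun r => edist q (γ r)) (dist x q) := by fun_prop
    refine hcont.eventually_lt_const ?_
    simpa only [hγq, edist_self] using pos_iff_ne_zero.2 (mul_ne_zero hratio hdiam)
  have hpinned : pinnedDistanceSet x C ∈ 𝓝[>] dist x q := by
    filter_upwards [self_mem_nhdsWithin, nhdsWithin_le_nhds hnear] with r hr hnear_r
    have hr₀ : 0 ≤ r := dist_nonneg.trans (mem_Ioi.1 hr).le
    have hball : G ⊆ Metric.ball x r := fun p hp =>
      Metric.mem_ball'.2 ((hfar (subset_closure hp)).trans_lt hr)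
    exact mem_pinnedDistanceSet_of_edist_lt hd hG hr₀ hball hq (Metric.mem_sphere'.2 (hdist r hr₀))
      hnear_r
  obtain ⟨u, hu, hsub⟩ := mem_nhdsGT_iff_exists_Ioo_subset.1 hpinned
  exact (nonempty_Ioo.2 hu).mono (interior_maximal hsub isOpen_Ioo)

end Thickness

section Line

theorem pathComponentIn_eq_of_closure_inter_subset {X : Type*} [TopologicalSpace X] {U F : Set X}
    {x : X} (hU : IsOpen U) (hUconn : IsPathConnected U) (hx : x ∈ U) (hUF : U ⊆ F)
    (hclosure : closure U ∩ F ⊆ U) : pathComponentIn F x = U := by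
  have hconn : IsPreconnected (pathComponentIn F x) :=
    (isPathConnected_pathComponentIn (hUF hx)).isConnected.isPreconnected
  refine Subset.antisymm ?_ (hUconn.subset_pathComponentIn hx hUF)
  exact hconn.subset_of_closure_inter_subset hU ⟨x, mem_pathComponentIn_self (hUF hx), hx⟩
    ((inter_subset_inter_right _ pathComponentIn_subset).trans hclosure)

/-- The identification of the line with `EuclideanSpace ℝ (Fin 1)`, used to read off the
one-dimensional case of the thickness from the order of `ℝ`. -/
noncomputable def lineIsometry : ℝ ≃ₗᵢ[ℝ] EuclideanSpace ℝ (Fin 1) :=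
  (OrthonormalBasis.singleton (Fin 1) ℝ).repr

variable {C : Set (EuclideanSpace ℝ (Fin 1))} {a b : ℝ}

theorem isPathConnected_image_lineIsometry {s : Set ℝ} (hs : s.OrdConnected) (hn : s.Nonempty) :
    IsPathConnected (lineIsometry '' s) :=
  (hs.convex.isPathConnected hn).image lineIsometry.continuous

theorem image_Ioo_mem_boundedGaps (hab : IsGap (lineIsometry ⁻¹' C) a b) :
    lineIsometry '' Ioo a b ∈ boundedGaps C := by
  have hcompl : lineIsometry '' Ioo a b ⊆ Cᶜ := by
    rintro _ ⟨t, ht, rfl⟩ htC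
    exact (hab.le_or_le t htC).elim (not_le.2 ht.1) (not_le.2 ht.2)
  have hclosure : closure (lineIsometry '' Ioo a b) ∩ Cᶜ ⊆ lineIsometry '' Ioo a b := by
    rw [← lineIsometry.coe_toHomeomorph, ← Homeomorph.image_closure, closure_Ioo hab.lt.ne]
    rintro _ ⟨⟨t, ht, rfl⟩, htC⟩
    have hta : t ≠ a := fun h => htC (h ▸ hab.left_mem)
    have htb : t ≠ b := fun h => htC (h ▸ hab.right_mem)
    exact ⟨t, ⟨ht.1.lt_of_ne' hta, ht.2.lt_of_ne htb⟩, rfl⟩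
  obtain ⟨t, ht⟩ := nonempty_Ioo.2 hab.lt
  have hmem : lineIsometry t ∈ lineIsometry '' Ioo a b := mem_image_of_mem lineIsometry ht
  refine ⟨⟨lineIsometry t, hcompl hmem, ?_⟩,
    lineIsometry.lipschitz.isBounded_image (Metric.isBounded_Ioo a b)⟩
  exact (pathComponentIn_eq_of_closure_inter_subset
    (lineIsometry.toHomeomorph.isOpenMap _ isOpen_Ioo)
    (isPathConnected_image_lineIsometry ordConnected_Ioo ⟨t, ht⟩) hmem hcompl hclosure).symm

theorem mul_le_dist_of_isGap {τ : ℝ} (hτ : 0 ≤ τ) (hτC : ENNReal.ofReal τ ≤ gapRatioInf C)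
    (hab : IsGap (lineIsometry ⁻¹' C) a b) {s : Set ℝ} (hs : s.OrdConnected) (hn : s.Nonempty)
    (hsC : Disjoint s (lineIsometry ⁻¹' C)) (hsab : ¬ s ⊆ Ioo a b)
    (hlen : ENNReal.ofReal (b - a) ≤ Metric.ediam s) {p q : ℝ} (hp : p ∈ Icc a b)
    (hq : q ∈ closure s) : τ * (b - a) ≤ dist p q := by
  have hediam : ∀ u : Set ℝ, Metric.ediam (lineIsometry '' u) = Metric.ediam u :=
    lineIsometry.isometry.ediam_image
  have hlarger : lineIsometry '' s ⊆ largerGaps C (lineIsometry '' Ioo a b) := by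
    refine subset_largerGaps (isPathConnected_image_lineIsometry hs hn) ?_ ?_ ?_
    · exact image_subset_iff.2 hsC.subset_compl_right
    · rwa [image_subset_image_iff lineIsometry.injective]
    · rwa [hediam, hediam, Real.ediam_Ioo]
  rw [← closure_Ioo hab.lt.ne] at hp
  have hle := gapRatioInf_mul_ediam_le (image_Ioo_mem_boundedGaps hab)
    (image_closure_subset_closure_image lineIsometry.continuous (mem_image_of_mem _ hp))
    (closure_mono hlarger
      (image_closure_subset_closure_image lineIsometry.continuous (mem_image_of_mem _ hq)))
  rw [lineIsometry.isometry.edist_eq, hediam, Real.ediam_Ioo, edist_dist] at hle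
  rw [← ENNReal.ofReal_le_ofReal_iff dist_nonneg, ENNReal.ofReal_mul hτ]
  exact (mul_le_mul_left hτC _).trans hle

theorem mul_le_dist_of_isGap_of_isGap {τ : ℝ} (hτ : 0 ≤ τ)
    (hτC : ENNReal.ofReal τ ≤ gapRatioInf C) {c e : ℝ} (hab : IsGap (lineIsometry ⁻¹' C) a b)
    (hce : IsGap (lineIsometry ⁻¹' C) c e) (hle : b - a ≤ e - c) (hne : ¬ (a ≤ c ∧ e ≤ b)) {p q : ℝ}
    (hp : p ∈ Icc a b) (hq : q ∈ Icc c e) : τ * (b - a) ≤ dist p q := by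
  have hdisj : Disjoint (Ioo c e) (lineIsometry ⁻¹' C) :=
    disjoint_right.2 fun z hz hzce => (hce.le_or_le z hz).elim hzce.1.not_ge hzce.2.not_ge
  refine mul_le_dist_of_isGap hτ hτC hab ordConnected_Ioo (nonempty_Ioo.2 hce.lt) hdisj ?_ ?_ hp ?_
  · rwa [Ioo_subset_Ioo_iff hce.lt]
  · rw [Real.ediam_Ioo]
    exact ENNReal.ofReal_le_ofReal hle
  · rwa [closure_Ioo hce.lt.ne]

theorem mul_le_dist_of_isGap_of_not_isBounded {τ : ℝ} (hτ : 0 ≤ τ)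
    (hτC : ENNReal.ofReal τ ≤ gapRatioInf C) (hab : IsGap (lineIsometry ⁻¹' C) a b) {s : Set ℝ}
    (hs : s.OrdConnected) (hsC : Disjoint s (lineIsometry ⁻¹' C)) (hbdd : ¬ Bornology.IsBounded s)
    {p q : ℝ} (hp : p ∈ Icc a b) (hq : q ∈ closure s) : τ * (b - a) ≤ dist p q := by
  refine mul_le_dist_of_isGap hτ hτC hab hs (closure_nonempty_iff.1 ⟨q, hq⟩) hsC ?_ ?_ hp hq
  · exact fun h => hbdd ((Metric.isBounded_Ioo a b).subset h)
  · rw [not_ne_iff.1 (mt Metric.isBounded_iff_ediam_ne_top.2 hbdd)]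
    exact le_top

theorem isThick_preimage_lineIsometry (hC : IsCompact C) {τ : ℝ} (hτ : 0 ≤ τ)
    (hτC : ENNReal.ofReal τ ≤ gapRatioInf C) : IsThick (lineIsometry ⁻¹' C) τ := by
  have hK : IsCompact (lineIsometry ⁻¹' C) := lineIsometry.toHomeomorph.isCompact_preimage.2 hC
  refine ⟨fun a b c e hab hce hbc => ?_, fun a b hab => ?_, fun a b hab => ?_⟩
  · have hdist : dist b c = c - b := by rw [dist_comm, Real.dist_eq, abs_of_nonneg (by linarith)]
    have hb : b ∈ Icc a b := right_mem_Icc.2 hab.lt.le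
    have hc : c ∈ Icc c e := left_mem_Icc.2 hce.lt.le
    rw [← hdist]
    rcases le_total (b - a) (e - c) with hle | hle
    · exact Or.inl (mul_le_dist_of_isGap_of_isGap hτ hτC hab hce hle
        (fun h => (hbc.trans_lt hce.lt).not_ge h.2) hb hc)
    · exact Or.inr (dist_comm b c ▸ mul_le_dist_of_isGap_of_isGap hτ hτC hce hab hle
        (fun h => (hab.lt.trans_le hbc).not_ge h.1) hc hb)
  · obtain ⟨z, hz, hmin⟩ := hK.exists_isLeast ⟨a, hab.left_mem⟩
    have hle := mul_le_dist_of_isGap_of_not_isBounded hτ hτC hab (q := z) ordConnected_Iio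
      (disjoint_right.2 fun t ht htz => (hmin ht).not_gt htz)
      (fun h => not_bddBelow_Iio z h.bddBelow) (left_mem_Icc.2 hab.lt.le) (by simp)
    exact ⟨z, hz, by rwa [Real.dist_eq, abs_of_nonneg (sub_nonneg.2 (hmin hab.left_mem))] at hle⟩
  · obtain ⟨z, hz, hmax⟩ := hK.exists_isGreatest ⟨b, hab.right_mem⟩
    have hle := mul_le_dist_of_isGap_of_not_isBounded hτ hτC hab (q := z) ordConnected_Ioi
      (disjoint_right.2 fun t ht hzt => (hmax ht).not_gt hzt)
      (fun h => not_bddAbove_Ioi z h.bddAbove) (right_mem_Icc.2 hab.lt.le) (by simp)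
    exact ⟨z, hz, by
      rwa [dist_comm, Real.dist_eq, abs_of_nonneg (sub_nonneg.2 (hmax hab.right_mem))] at hle⟩

theorem exists_isGap_preimage_lineIsometry (hC : IsCompact C) (hgap : (boundedGaps C).Nonempty) :
    ∃ a b, IsGap (lineIsometry ⁻¹' C) a b := by
  have hK : IsCompact (lineIsometry ⁻¹' C) := lineIsometry.toHomeomorph.isCompact_preimage.2 hC
  obtain ⟨_, ⟨p, hp, rfl⟩, hbdd⟩ := hgap
  obtain ⟨y, rfl⟩ := lineIsometry.surjective p
  have inter_nonempty : ∀ s : Set ℝ, s.OrdConnected → y ∈ s → ¬ Bornology.IsBounded s →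
      (s ∩ lineIsometry ⁻¹' C).Nonempty := by
    intro s hs hys hsbdd
    rw [← not_disjoint_iff_nonempty_inter]
    intro hdisj
    have hsub : lineIsometry '' s ⊆ pathComponentIn Cᶜ (lineIsometry y) :=
      (isPathConnected_image_lineIsometry hs ⟨y, hys⟩).subset_pathComponentIn
        (mem_image_of_mem _ hys) (image_subset_iff.2 hdisj.subset_compl_right)
    exact hsbdd ((lineIsometry.antilipschitz.isBounded_preimage hbdd).subset
      (image_subset_iff.1 hsub))
  obtain ⟨u, huy, hu⟩ := inter_nonempty (Iic y) ordConnected_Iic self_mem_Iic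
    fun h => not_bddBelow_Iic y h.bddBelow
  obtain ⟨v, hyv, hv⟩ := inter_nonempty (Ici y) ordConnected_Ici self_mem_Ici
    fun h => not_bddAbove_Ici y h.bddAbove
  obtain ⟨a, b, hab, -⟩ := exists_isGap_of_notMem hK hu hv hp huy hyv
  exact ⟨a, b, hab⟩

theorem image_sq_pinnedDistanceSet_lineIsometry (C : Set (EuclideanSpace ℝ (Fin 1))) (s : ℝ) :
    (· ^ 2) '' pinnedDistanceSet (lineIsometry s) C =
      (fun t => (t - s) ^ 2) '' (lineIsometry ⁻¹' C) := by
  rw [pinnedDistanceSet_eq_image_dist, ← image_preimage_eq C lineIsometry.surjective, image_image,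
    image_image, preimage_image_eq _ lineIsometry.injective]
  refine image_congr fun t _ => ?_
  rw [lineIsometry.dist_map, dist_comm, Real.dist_eq, sq_abs]

end Line

section SquaredDistances

theorem containsThick_image_of_interior_nonempty {D : Set ℝ} (hD : (interior D).Nonempty)
    {f : ℝ → ℝ} (hf : ContinuousOn f D) (hinj : InjOn f D) (τ : ℝ) : ContainsThick (f '' D) τ := by
  obtain ⟨t, ht⟩ := hD
  obtain ⟨ε, hε, hsub⟩ := Metric.nhds_basis_closedBall.mem_iff.1 (mem_interior_iff_mem_nhds.1 ht)
  have hconn : IsPreconnected (f '' Metric.closedBall t ε) :=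
    (convex_closedBall t ε).isPreconnected.image f (hf.mono hsub)
  have hnontrivial : (Metric.closedBall t ε).Nontrivial :=
    (infinite_of_mem_nhds t (Metric.closedBall_mem_nhds t hε)).nontrivial
  exact ⟨f '' Metric.closedBall t ε, image_mono hsub,
    (isCompact_closedBall t ε).image_of_continuousOn (hf.mono hsub),
    hnontrivial.image_of_injOn (hinj.mono hsub), isThick_of_ordConnected hconn.ordConnected τ⟩

theorem pinnedDistanceSet_subset_Ici {E : Type*} [NormedAddCommGroup E] (x : E) (C : Set E) :
    pinnedDistanceSet x C ⊆ Ici 0 := by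
  rintro _ ⟨y, -, rfl⟩
  exact norm_nonneg (x - y)

theorem interior_nonempty_of_image_sq {D : Set ℝ} (hD : D ⊆ Ici 0)
    (h : (interior ((· ^ 2) '' D)).Nonempty) : (interior D).Nonempty := by
  obtain ⟨s, hs, hs_pos⟩ : ∃ s ∈ interior ((· ^ 2) '' D), s ≠ 0 := by
    obtain ⟨p, hp⟩ := h
    exact (infinite_of_mem_nhds p (isOpen_interior.mem_nhds hp)).nontrivial.exists_ne 0
  obtain ⟨t, ht, rfl⟩ := interior_subset hs
  have ht_pos : 0 < t := (hD ht).lt_of_ne' (by rintro rfl; simp at hs_pos)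
  refine ⟨t, mem_interior_iff_mem_nhds.2 ?_⟩
  have hcont : ContinuousAt (· ^ 2) t := by fun_prop
  filter_upwards [hcont (mem_interior_iff_mem_nhds.1 hs), lt_mem_nhds ht_pos] with u hu hu_pos
  obtain ⟨v, hv, hvu⟩ := hu
  rwa [← (pow_left_inj₀ (hD hv) hu_pos.le two_ne_zero).1 hvu]

theorem containsThick_image_sq_pinnedDistanceSet {d : ℕ} (hd : 1 ≤ d)
    {C : Set (EuclideanSpace ℝ (Fin d))} (hC : IsCompact C) {τ : ℝ} (hτ : 0 < τ)
    (hτC : ENNReal.ofReal τ < thickness C) (x : EuclideanSpace ℝ (Fin d)) :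
    ContainsThick ((· ^ 2) '' pinnedDistanceSet x C) τ := by
  have of_interior (h : (interior (pinnedDistanceSet x C)).Nonempty) :
      ContainsThick ((· ^ 2) '' pinnedDistanceSet x C) τ :=
    containsThick_image_of_interior_nonempty h (by fun_prop)
      ((pow_left_strictMonoOn₀ two_ne_zero).injOn.mono (pinnedDistanceSet_subset_Ici x C)) τ
  have : Nonempty (Fin d) := ⟨⟨0, hd⟩⟩
  by_cases hint : (interior C).Nonempty
  · exact of_interior (interior_pinnedDistanceSet_nonempty hint x)
  have hgap := boundedGaps_nonempty_of_thickness_ne_zero hint (ne_bot_of_gt hτC)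
  rw [thickness_eq_gapRatioInf hgap] at hτC
  rcases hd.eq_or_lt' with rfl | hd₂
  · obtain ⟨s, rfl⟩ := lineIsometry.surjective x
    obtain ⟨σ, hσ, hτσ, hσC⟩ := ENNReal.lt_iff_exists_real_btwn.1 hτC
    have hK : IsCompact (lineIsometry ⁻¹' C) := lineIsometry.toHomeomorph.isCompact_preimage.2 hC
    have hKint : interior (lineIsometry ⁻¹' C) = ∅ := by
      rw [← lineIsometry.coe_toHomeomorph, ← Homeomorph.preimage_interior,
        not_nonempty_iff_eq_empty.1 hint, preimage_empty]
    rw [image_sq_pinnedDistanceSet_lineIsometry]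
    exact (isThick_preimage_lineIsometry hC hσ hσC.le).containsThick_image_sub_sq hK hKint
      (exists_isGap_preimage_lineIsometry hC hgap) hτ (ENNReal.ofReal_lt_ofReal_iff'.1 hτσ).1 s
  · exact of_interior (interior_pinnedDistanceSet_nonempty_of_two_le hd₂ hC.isClosed hgap
      (ne_bot_of_gt hτC) x)

theorem image_sq_pinnedDistanceSet_prod {E F : Type*} [NormedAddCommGroup E] [NormedAddCommGroup F]
    (A : Set E) (B : Set F) (x : WithLp 2 (E × F)) :
    (· ^ 2) '' pinnedDistanceSet x {z | z.fst ∈ A ∧ z.snd ∈ B} =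
      (· ^ 2) '' pinnedDistanceSet x.fst A + (· ^ 2) '' pinnedDistanceSet x.snd B := by
  ext t
  constructor
  · rintro ⟨_, ⟨y, ⟨hyA, hyB⟩, rfl⟩, rfl⟩
    exact ⟨_, ⟨_, ⟨y.fst, hyA, rfl⟩, rfl⟩, _, ⟨_, ⟨y.snd, hyB, rfl⟩, rfl⟩,
      (WithLp.prod_norm_sq_eq_of_L2 (x - y)).symm⟩
  · rintro ⟨_, ⟨_, ⟨a, ha, rfl⟩, rfl⟩, _, ⟨_, ⟨b, hb, rfl⟩, rfl⟩, rfl⟩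
    exact ⟨_, ⟨WithLp.toLp 2 (a, b), ⟨ha, hb⟩, rfl⟩,
      WithLp.prod_norm_sq_eq_of_L2 (x - WithLp.toLp 2 (a, b))⟩

end SquaredDistances

theorem exists_real_lt_of_one_lt_mul {a b : ℝ≥0∞} (h : 1 < a * b) :
    ∃ s t : ℝ, 0 < s ∧ 0 < t ∧ ENNReal.ofReal s < a ∧ ENNReal.ofReal t < b ∧ 1 < s * t := by
  obtain ⟨a', ha', b', hb', hab⟩ : ∃ a' < a, ∃ b' < b, 1 < a' * b' := by
    by_contra! hle
    exact h.not_ge (ENNReal.mul_le_of_forall_lt hle)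
  lift a' to NNReal using ha'.ne_top
  lift b' to NNReal using hb'.ne_top
  have hab' : 1 < a' * b' := by exact_mod_cast hab
  have hpos : 0 < a' * b' := one_pos.trans hab'
  have ha'_pos : 0 < a' := pos_of_mul_pos_left hpos zero_le
  have hb'_pos : 0 < b' := pos_of_mul_pos_right hpos zero_le
  exact ⟨a', b', ha'_pos, hb'_pos, by rwa [ENNReal.ofReal_coe_nnreal],
    by rwa [ENNReal.ofReal_coe_nnreal], by exact_mod_cast hab'⟩

theorem mainTheorem3_general {d₁ d₂ : ℕ} (hd₁ : 1 ≤ d₁) (hd₂ : 1 ≤ d₂)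
    {C₁ : Set (EuclideanSpace ℝ (Fin d₁))} {C₂ : Set (EuclideanSpace ℝ (Fin d₂))}
    (hC₁ : IsCompact C₁) (hC₂ : IsCompact C₂) (hτ : 1 < thickness C₁ * thickness C₂)
    (x : WithLp 2 (EuclideanSpace ℝ (Fin d₁) × EuclideanSpace ℝ (Fin d₂))) :
    (interior (pinnedDistanceSet x {z | z.fst ∈ C₁ ∧ z.snd ∈ C₂})).Nonempty := by
  obtain ⟨τ₁, τ₂, hτ₁, hτ₂, hlt₁, hlt₂, hmul⟩ := exists_real_lt_of_one_lt_mul hτ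
  refine interior_nonempty_of_image_sq (pinnedDistanceSet_subset_Ici x _) ?_
  rw [image_sq_pinnedDistanceSet_prod]
  exact (containsThick_image_sq_pinnedDistanceSet hd₁ hC₁ hτ₁ hlt₁ x.fst).interior_add_nonempty
    (containsThick_image_sq_pinnedDistanceSet hd₂ hC₂ hτ₂ hlt₂ x.snd) hτ₁ hτ₂ hmul

theorem mainTheorem3 {d : ℕ} (hd : 1 ≤ d) (C₁ C₂ : Set (EuclideanSpace ℝ (Fin d)))
    (hC₁ : IsCompact C₁) (hC₂ : IsCompact C₂)
    (hτ : 1 < thickness C₁ * thickness C₂)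
    (x : WithLp 2 (EuclideanSpace ℝ (Fin d) × EuclideanSpace ℝ (Fin d)))
    (hx : x ∈ euclideanProd C₁ C₂) :
    (interior (pinnedDistanceSet x (euclideanProd C₁ C₂))).Nonempty :=
  mainTheorem3_general hd hd hC₁ hC₂ hτ x
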